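/- For every constant $c>0$ there are constants $0<a\le b$, depending only on $c$, and a choice of thresholds $\Delta=\Delta_n$, depending only on $c$ and $n$, with $\frac{a}{\sqrt{\log n}}\le \Delta_n\le \frac{b}{\sqrt{\log n}}$ for all $n\ge 2$ (that is, $\Delta_n=\Theta_c(1/\sqrt{\log n})$), such that the following holds for all $n$ and $m$. Let $\{v_i\}_{i\in V}\subseteq\mathbb{R}^m$ be a family of $|V|=n$ vectors satisfying the squared-$\ell_2$ triangle inequality $$\|v_i-v_j\|_2^2\le \|v_i-v_k\|_2^2+\|v_k-v_j\|_2^2\qquad\text{for all } i,j,k\in V.$$ For $g\in\mathbb{R}^m$ define the set of directed edges $$E(g):=\{(i,j)\in V\times V \;:\; \langle v_j-v_i,g\rangle\ge 2 \text{ and } \|v_i-v_j\|_2^2\le\Delta_n\},$$ and let $\beta(E(g))$ be the maximum size of a matching contained in $E(g)$, i.e. of a set of edges of $E(g)$ no two of which share an endpoint. Then, for a standard Gaussian vector $g\sim N^m(0,1)$ in $\mathbb{R}^m$, $$\mathbb{E}_{g}\big[\beta(E(g))\big]\le c\,n.$$ -/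

import Mathlib

/-- A finite set `M` of directed edges on `V` is a matching: it has no loops, and two different edges
of `M` have no endpoint in common (orientations play no role). -/
def IsEdgeMatching {V : Type*} (M : Finset (V × V)) : Prop :=
  (∀ e ∈ M, e.1 ≠ e.2) ∧
    ∀ e ∈ M, ∀ f ∈ M, e ≠ f → e.1 ≠ f.1 ∧ e.1 ≠ f.2 ∧ e.2 ≠ f.1 ∧ e.2 ≠ f.2

open Classical in
/-- `β(E)`: the size of a maximum matching contained in the edge set `E`. -/
noncomputable def maxMatchingSize {V : Type*} [Fintype V] (E : Set (V × V)) : ℕ :=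
  ((Finset.univ : Finset (Finset (V × V))).filter
    (fun M => (∀ e ∈ M, e ∈ E) ∧ IsEdgeMatching M)).sup Finset.card

/-- The squared Euclidean distances of the vectors `v i` satisfy the triangle inequality. -/
def SqTriangleInequality {V : Type*} {m : ℕ} (v : V → EuclideanSpace ℝ (Fin m)) : Prop :=
  ∀ i j k : V, ‖v i - v j‖ ^ 2 ≤ ‖v i - v k‖ ^ 2 + ‖v k - v j‖ ^ 2

/-- `E(g)`: the directed edges `(i, j)` with `⟨v j - v i, g⟩ ≥ 2` and `‖v i - v j‖² ≤ Δ`. -/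
def stretchedEdges {V : Type*} {m : ℕ} (v : V → EuclideanSpace ℝ (Fin m)) (Δ : ℝ)
    (g : EuclideanSpace ℝ (Fin m)) : Set (V × V) :=
  {e | 2 ≤ inner ℝ (v e.2 - v e.1) g ∧ ‖v e.1 - v e.2‖ ^ 2 ≤ Δ}

/-! Let Z_r(i, g) be `maxStretch`: the largest ⟨v j - v i, g⟩ over the j at squared distance at most
r from i. By the triangle inequality, a stretched edge (i, j) forces Z_{r+Δ}(i, g) ≥ Z_r(j, g) + 2.
The reversed edge is stretched for -g, so Z_{r+Δ}(j, -g) ≥ Z_r(i, -g) + 2. A maximum of Gaussians of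
standard deviation at most √r has mean absolute deviation at most π√r, independently of n
(`integral_abs_supInner_sub_le`). Hence Z can be replaced by its mean, which no longer depends on g.
Adding both inequalities over a maximum matching and averaging over g, each increase of the radius
by Δ raises the mean stretch, weighted by the cover probabilities, by 4·E[β] minus an error 4πn√ρ,
as long as the radii stay below ρ (`four_mul_expectedMatchingSize_le`). If E[β] > cn and √ρ is a
small multiple of c, then K ≈ ρ/Δ steps give a weighted mean of at least 2K·E[β]. The exponential
moment bound `integral_supInner_le` caps it at 2·E[β]·(Δ log n + K/2), a contradiction once K > 2Δ
log n, which holds for Δ a small multiple of 1/√(log n). -/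

open MeasureTheory ProbabilityTheory

/-! ### Maxima of finitely many linear functionals -/

section MaximumOfFunctionals

variable {E : Type*} [NormedAddCommGroup E] [InnerProductSpace ℝ E] {ι : Type*}

/-- The maximum of finitely many linear functionals. -/
noncomputable def supInner (S : Finset ι) (hS : S.Nonempty) (w : ι → E) (x : E) : ℝ :=
  S.sup' hS fun j => inner ℝ (w j) x

variable {S : Finset ι} {hS : S.Nonempty} {w : ι → E} {L : ℝ}

theorem inner_le_supInner {j : ι} (hj : j ∈ S) (x : E) : inner ℝ (w j) x ≤ supInner S hS w x :=
  Finset.le_sup' (fun j => inner ℝ (w j) x) hj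

theorem exists_supInner_eq (S : Finset ι) (hS : S.Nonempty) (w : ι → E) (x : E) :
    ∃ j ∈ S, supInner S hS w x = inner ℝ (w j) x :=
  Finset.exists_mem_eq_sup' hS _

theorem continuous_supInner : Continuous (supInner S hS w) :=
  Continuous.finset_sup'_apply hS fun _ _ => by fun_prop

theorem abs_supInner_le (hw : ∀ j ∈ S, ‖w j‖ ≤ L) (x : E) : |supInner S hS w x| ≤ L * ‖x‖ := by
  obtain ⟨j, hj, h⟩ := exists_supInner_eq S hS w x
  rw [h]
  exact (abs_real_inner_le_norm _ _).trans (by gcongr; exact hw j hj)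

end MaximumOfFunctionals

/-! ### Mean and concentration of a Gaussian maximum -/

section GaussianMaximum

variable {E : Type*} [NormedAddCommGroup E] [InnerProductSpace ℝ E] [FiniteDimensional ℝ E]
  [MeasurableSpace E] [BorelSpace E]
  {ι : Type*} {S : Finset ι} {hS : S.Nonempty} {w : ι → E} {L : ℝ}

/-- The law of a linear functional under the standard Gaussian measure. -/
theorem map_inner_stdGaussian (w : E) :
    (stdGaussian E).map (fun x => inner ℝ w x) = gaussianReal 0 (‖w‖ ^ 2).toNNReal := by
  have h := IsGaussian.map_eq_gaussianReal (μ := stdGaussian E) (innerSL ℝ w)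
  rw [integral_strongDual_stdGaussian, variance_dual_stdGaussian, innerSL_apply_norm] at h
  exact h

theorem integrable_inner_stdGaussian (w : E) :
    Integrable (fun x => inner ℝ w x) (stdGaussian E) :=
  IsGaussian.integrable_dual (stdGaussian E) (innerSL ℝ w)

/-- The variance of |⟨w, x⟩| is nonnegative and its second moment is ‖w‖². -/
theorem integral_abs_inner_stdGaussian_le (w : E) :
    ∫ x, |inner ℝ w x| ∂(stdGaussian E) ≤ ‖w‖ := by
  have hm : MemLp (fun x : E => |inner ℝ w x|) 2 (stdGaussian E) :=
    (IsGaussian.memLp_dual (stdGaussian E) (innerSL ℝ w) 2 (by norm_num)).abs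
  have h0 := variance_nonneg (fun x : E => |inner ℝ w x|) (stdGaussian E)
  have hv := variance_dual_stdGaussian (innerSL ℝ w : StrongDual ℝ E)
  rw [variance_eq_sub (IsGaussian.memLp_dual (stdGaussian E) (innerSL ℝ w) 2 (by norm_num)),
    integral_strongDual_stdGaussian, innerSL_apply_norm] at hv
  rw [variance_eq_sub hm] at h0
  have h1 : (stdGaussian E)[(fun x : E => |inner ℝ w x|) ^ 2] = ‖w‖ ^ 2 := by
    rw [← hv]; simp [sq_abs]
  rw [h1] at h0
  exact abs_le_of_sq_le_sq' (by linarith) (norm_nonneg w) |>.2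

theorem integrable_exp_inner_stdGaussian (w : E) (t : ℝ) :
    Integrable (fun x => Real.exp (t * inner ℝ w x)) (stdGaussian E) := by
  have h := integrable_exp_mul_gaussianReal (μ := 0) (v := (‖w‖ ^ 2).toNNReal) t
  rw [← map_inner_stdGaussian w] at h
  exact h.comp_measurable (by fun_prop)

theorem integral_exp_inner_stdGaussian (w : E) (t : ℝ) :
    ∫ x, Real.exp (t * inner ℝ w x) ∂(stdGaussian E) = Real.exp (t ^ 2 * ‖w‖ ^ 2 / 2) := by
  have h := mgf_gaussianReal (map_inner_stdGaussian w) t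
  rw [mgf] at h
  rw [h, Real.coe_toNNReal _ (by positivity)]
  ring_nf

/-- Rotating two independent standard Gaussian vectors. -/
theorem measurePreserving_rotation_stdGaussian (θ : ℝ) :
    MeasurePreserving (ContinuousLinearMap.rotation (E := E) θ)
      ((stdGaussian E).prod (stdGaussian E)) ((stdGaussian E).prod (stdGaussian E)) where
  measurable := by fun_prop
  map_eq := IsGaussian.map_rotation_eq_self (integral_id_stdGaussian) θ

theorem measurePreserving_cos_sin_stdGaussian (θ : ℝ) :
    MeasurePreserving (fun p : E × E => Real.cos θ • p.1 + Real.sin θ • p.2)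
      ((stdGaussian E).prod (stdGaussian E)) (stdGaussian E) :=
  measurePreserving_fst.comp (measurePreserving_rotation_stdGaussian θ)

theorem integrable_supInner : Integrable (supInner S hS w) (stdGaussian E) := by
  refine Integrable.mono' (IsGaussian.integrable_id.norm.const_mul (∑ j ∈ S, ‖w j‖))
    continuous_supInner.aestronglyMeasurable (ae_of_all _ fun x => ?_)
  exact abs_supInner_le (fun j hj => Finset.single_le_sum (fun i _ => norm_nonneg (w i)) hj) x

/-- The expected maximum of finitely many Gaussian variables. -/
theorem integral_supInner_le (hw : ∀ j ∈ S, ‖w j‖ ≤ L) {t : ℝ} (ht : 0 < t) :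
    ∫ x, supInner S hS w x ∂(stdGaussian E) ≤ (Real.log S.card + t ^ 2 * L ^ 2 / 2) / t := by
  set a := Real.log S.card + t ^ 2 * L ^ 2 / 2 with ha
  have hL (j) (hj : j ∈ S) : ‖w j‖ ^ 2 ≤ L ^ 2 := by
    have := hw j hj
    gcongr
  have hcard : (0 : ℝ) < S.card := by exact_mod_cast hS.card_pos
  have hsum : Integrable (fun x => ∑ j ∈ S, Real.exp (t * inner ℝ (w j) x)) (stdGaussian E) :=
    integrable_finsetSum _ fun j _ => integrable_exp_inner_stdGaussian (w j) t
  -- The tangent bound `u + 1 ≤ exp u` at u = t · max - a plays the role of Jensen's inequality; a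
  -- is the logarithm of the bound on the sum of exponential moments.
  have hpt (x : E) : t * supInner S hS w x ≤
      (a - 1) + Real.exp (-a) * ∑ j ∈ S, Real.exp (t * inner ℝ (w j) x) := by
    obtain ⟨j, hj, h⟩ := exists_supInner_eq S hS w x
    have h1 : Real.exp (t * inner ℝ (w j) x) ≤ ∑ j ∈ S, Real.exp (t * inner ℝ (w j) x) :=
      Finset.single_le_sum (f := fun j => Real.exp (t * inner ℝ (w j) x))
        (fun i _ => (Real.exp_pos _).le) hj
    have h2 := Real.add_one_le_exp (-a + t * inner ℝ (w j) x)
    rw [Real.exp_add] at h2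
    have h3 := mul_le_mul_of_nonneg_left h1 (Real.exp_pos (-a)).le
    rw [h]
    linarith
  have hint : t * ∫ x, supInner S hS w x ∂(stdGaussian E) ≤
      (a - 1) + Real.exp (-a) * ∑ j ∈ S, Real.exp (t ^ 2 * ‖w j‖ ^ 2 / 2) := by
    have := integral_mono (integrable_supInner.const_mul t)
      ((integrable_const (a - 1)).add (hsum.const_mul (Real.exp (-a)))) hpt
    simp only [Pi.add_apply] at this
    rw [integral_const_mul, integral_add (integrable_const _) (hsum.const_mul _),
      integral_const_mul, integral_finsetSum _
        (fun j _ => integrable_exp_inner_stdGaussian (w j) t)] at this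
    simpa [integral_exp_inner_stdGaussian] using this
  have hle : ∑ j ∈ S, Real.exp (t ^ 2 * ‖w j‖ ^ 2 / 2) ≤ Real.exp a := by
    calc ∑ j ∈ S, Real.exp (t ^ 2 * ‖w j‖ ^ 2 / 2)
        ≤ ∑ j ∈ S, Real.exp (t ^ 2 * L ^ 2 / 2) := by
          refine Finset.sum_le_sum fun j hj => ?_
          have := hL j hj
          gcongr
      _ = Real.exp a := by
          rw [Finset.sum_const, nsmul_eq_mul, ha, Real.exp_add, Real.exp_log hcard]
  have h1 : Real.exp (-a) * Real.exp a = 1 := by rw [← Real.exp_add]; simp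
  have h2 := mul_le_mul_of_nonneg_left hle (Real.exp_pos (-a)).le
  rw [le_div_iff₀ ht]
  linarith

/-- The mean displacement of `supInner` under a rotation by the angle `θ`. -/
noncomputable def rotationDisplacement (S : Finset ι) (hS : S.Nonempty) (w : ι → E) (θ : ℝ) : ℝ :=
  ∫ p : E × E, |supInner S hS w p.1 - supInner S hS w (Real.cos θ • p.1 + Real.sin θ • p.2)|
    ∂((stdGaussian E).prod (stdGaussian E))

theorem integrable_supInner_fst :
    Integrable (fun p : E × E => supInner S hS w p.1)
      ((stdGaussian E).prod (stdGaussian E)) :=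
  measurePreserving_fst.integrable_comp_of_integrable integrable_supInner

theorem integrable_supInner_rotation (θ : ℝ) :
    Integrable (fun p : E × E => supInner S hS w (Real.cos θ • p.1 + Real.sin θ • p.2))
      ((stdGaussian E).prod (stdGaussian E)) :=
  (measurePreserving_cos_sin_stdGaussian θ).integrable_comp_of_integrable integrable_supInner

/-- Rotation by θ preserves the product measure, so the displacement from angle θ to θ + h has the
same mean as from 0 to h; the triangle inequality for |·| then applies. -/
theorem rotationDisplacement_add_le (θ h : ℝ) :
    rotationDisplacement S hS w (θ + h) ≤
      rotationDisplacement S hS w θ + rotationDisplacement S hS w h := by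
  have hG : rotationDisplacement S hS w h =
      ∫ p : E × E, |supInner S hS w (Real.cos θ • p.1 + Real.sin θ • p.2) -
        supInner S hS w (Real.cos (θ + h) • p.1 + Real.sin (θ + h) • p.2)|
        ∂((stdGaussian E).prod (stdGaussian E)) := by
    have hc : Continuous fun p : E × E =>
        |supInner S hS w p.1 - supInner S hS w (Real.cos h • p.1 + Real.sin h • p.2)| := by
      have := continuous_supInner (S := S) (hS := hS) (w := w)
      fun_prop
    rw [rotationDisplacement, ← (measurePreserving_rotation_stdGaussian (E := E) θ).map_eq,
      integral_map (by fun_prop) hc.aestronglyMeasurable,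
      (measurePreserving_rotation_stdGaussian (E := E) θ).map_eq]
    congr 1 with p
    simp only [ContinuousLinearMap.rotation_apply]
    congr 3
    rw [Real.cos_add, Real.sin_add]
    module
  rw [hG, rotationDisplacement, rotationDisplacement, ← integral_add]
  · refine integral_mono ?_ ?_ fun p => abs_sub_le _ _ _
    · exact (integrable_supInner_fst.sub (integrable_supInner_rotation _)).abs
    · exact (integrable_supInner_fst.sub (integrable_supInner_rotation _)).abs.add
        ((integrable_supInner_rotation _).sub (integrable_supInner_rotation _)).abs
  · exact (integrable_supInner_fst.sub (integrable_supInner_rotation _)).abs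
  · exact ((integrable_supInner_rotation _).sub (integrable_supInner_rotation _)).abs

theorem rotationDisplacement_nat_mul_le (n : ℕ) (h : ℝ) :
    rotationDisplacement S hS w (n * h) ≤ n * rotationDisplacement S hS w h := by
  induction n with
  | zero => simp [rotationDisplacement]
  | succ n ih =>
    have := rotationDisplacement_add_le (S := S) (hS := hS) (w := w) (n * h) h
    push_cast
    rw [add_mul, one_mul, add_mul, one_mul]
    linarith

/-- The difference F has mean zero, so E|F| is twice the mean of its positive part, which only needs
a lower bound for the rotated maximum. -/
theorem rotationDisplacement_le (hw : ∀ j ∈ S, ‖w j‖ ≤ L) (h : ℝ) :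
    rotationDisplacement S hS w h ≤
      2 * ((1 - Real.cos h) * ∫ x, |supInner S hS w x| ∂(stdGaussian E) + |Real.sin h| * L) := by
  set F : E × E → ℝ := fun p =>
    supInner S hS w p.1 - supInner S hS w (Real.cos h • p.1 + Real.sin h • p.2) with hF
  have hFi : Integrable F ((stdGaussian E).prod (stdGaussian E)) :=
    integrable_supInner_fst.sub (integrable_supInner_rotation h)
  have hF0 : ∫ p, F p ∂((stdGaussian E).prod (stdGaussian E)) = 0 := by
    rw [hF, integral_sub integrable_supInner_fst (integrable_supInner_rotation h)]
    have h1 := (measurePreserving_fst (μ := stdGaussian E) (ν := stdGaussian E)).map_eq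
    have h2 := (measurePreserving_cos_sin_stdGaussian (E := E) h).map_eq
    have e1 := integral_map (μ := (stdGaussian E).prod (stdGaussian E)) (φ := Prod.fst)
      (by fun_prop) (continuous_supInner (S := S) (hS := hS) (w := w)).aestronglyMeasurable
    have e2 := integral_map (μ := (stdGaussian E).prod (stdGaussian E))
      (φ := fun p : E × E => Real.cos h • p.1 + Real.sin h • p.2)
      (by fun_prop) (continuous_supInner (S := S) (hS := hS) (w := w)).aestronglyMeasurable
    rw [h1] at e1
    rw [h2] at e2
    rw [← e1, ← e2, sub_self]
  have hpos : ∫ p, max (F p) 0 ∂((stdGaussian E).prod (stdGaussian E)) ≤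
      (1 - Real.cos h) * ∫ x, |supInner S hS w x| ∂(stdGaussian E) + |Real.sin h| * L := by
    have hFp : Integrable (fun p => max (F p) 0) ((stdGaussian E).prod (stdGaussian E)) :=
      hFi.pos_part
    rw [integral_prod _ hFp, ← integral_const_mul]
    have hR : Integrable (fun x : E => (1 - Real.cos h) * |supInner S hS w x| + |Real.sin h| * L)
        (stdGaussian E) := (integrable_supInner.abs.const_mul _).add (integrable_const _)
    calc ∫ x, ∫ y, max (F (x, y)) 0 ∂(stdGaussian E) ∂(stdGaussian E)
        ≤ ∫ x, ((1 - Real.cos h) * |supInner S hS w x| + |Real.sin h| * L) ∂(stdGaussian E) := by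
          refine integral_mono_of_nonneg (ae_of_all _ fun x => integral_nonneg fun y =>
            le_max_right _ _) hR (ae_of_all _ fun x => ?_)
          -- The maximizer j at x is a competitor at the rotated point. It does not depend on y, so
          -- ⟨w j, y⟩ is a single Gaussian variable and no union bound over `S` is paid.
          obtain ⟨j, hj, hx⟩ := exists_supInner_eq S hS w x
          have hb (y : E) : max (F (x, y)) 0 ≤
              (1 - Real.cos h) * |supInner S hS w x| + |Real.sin h| * |inner ℝ (w j) y| := by
            have hc : 0 ≤ 1 - Real.cos h := by linarith [Real.cos_le_one h]
            refine max_le ?_ (by positivity)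
            have h1 := inner_le_supInner (hS := hS) (w := w) hj
              (Real.cos h • x + Real.sin h • y)
            rw [inner_add_right, real_inner_smul_right, real_inner_smul_right, ← hx] at h1
            have h2 := mul_le_mul_of_nonneg_left (le_abs_self (supInner S hS w x)) hc
            have h3 := neg_abs_le (Real.sin h * inner ℝ (w j) y)
            rw [abs_mul] at h3
            simp only [hF]
            linarith
          have hi : Integrable (fun y : E => (1 - Real.cos h) * |supInner S hS w x| +
              |Real.sin h| * |inner ℝ (w j) y|) (stdGaussian E) :=
            (integrable_const _).add ((integrable_inner_stdGaussian (w j)).abs.const_mul _)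
          calc ∫ y, max (F (x, y)) 0 ∂(stdGaussian E)
              ≤ ∫ y, ((1 - Real.cos h) * |supInner S hS w x| +
                  |Real.sin h| * |inner ℝ (w j) y|) ∂(stdGaussian E) :=
                integral_mono_of_nonneg (ae_of_all _ fun y => le_max_right _ _) hi
                  (ae_of_all _ hb)
            _ ≤ (1 - Real.cos h) * |supInner S hS w x| + |Real.sin h| * L := by
                rw [integral_add (integrable_const _)
                  ((integrable_inner_stdGaussian (w j)).abs.const_mul _)]
                have := (integral_abs_inner_stdGaussian_le (w j)).trans (hw j hj)
                simp only [integral_const_mul, integral_const, probReal_univ, one_smul]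
                gcongr
      _ = _ := by
          rw [integral_add (integrable_supInner.abs.const_mul _) (integrable_const _)]
          simp
  have habs (p : E × E) : |F p| = 2 * max (F p) 0 - F p := by
    rcases le_total 0 (F p) with h | h
    · rw [abs_of_nonneg h, max_eq_left h]; ring
    · rw [abs_of_nonpos h, max_eq_right h]; ring
  calc rotationDisplacement S hS w h
      = ∫ p, (2 * max (F p) 0 - F p) ∂((stdGaussian E).prod (stdGaussian E)) := by
        simp_rw [← habs]; rfl
    _ = 2 * ∫ p, max (F p) 0 ∂((stdGaussian E).prod (stdGaussian E)) := by
        rw [integral_sub (hFi.pos_part.const_mul 2) hFi, hF0, integral_const_mul, sub_zero]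
    _ ≤ _ := by gcongr

/-- Cut the quarter turn into N equal rotations. The term with A, which may depend on the size of
`S`, is quadratic in the angle and vanishes as N → ∞; the linear term sums to πL. -/
theorem rotationDisplacement_pi_div_two_le (hw : ∀ j ∈ S, ‖w j‖ ≤ L) :
    rotationDisplacement S hS w (Real.pi / 2) ≤ Real.pi * L := by
  have hL : 0 ≤ L := by
    obtain ⟨j, hj⟩ := hS
    exact (norm_nonneg _).trans (hw j hj)
  set A := ∫ x, |supInner S hS w x| ∂(stdGaussian E) with hA
  have hA0 : 0 ≤ A := integral_nonneg fun x => abs_nonneg _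
  have key (N : ℕ) (hN : 0 < N) : rotationDisplacement S hS w (Real.pi / 2) ≤
      (Real.pi / 2) ^ 2 * A * (1 / (N : ℝ)) + Real.pi * L := by
    have hN' : (0 : ℝ) < N := by exact_mod_cast hN
    set h := Real.pi / 2 / N with hh
    have hNh : N * h = Real.pi / 2 := by rw [hh]; field_simp
    have h0 : 0 ≤ h := by positivity
    have h1 := rotationDisplacement_nat_mul_le (S := S) (hS := hS) (w := w) N h
    have h2 := rotationDisplacement_le (hS := hS) hw h
    have h3 : 1 - Real.cos h ≤ h ^ 2 / 2 := by linarith [Real.one_sub_sq_div_two_le_cos (x := h)]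
    have h4 : |Real.sin h| ≤ h := by
      have := Real.abs_sin_le_abs (x := h)
      rwa [abs_of_nonneg h0] at this
    rw [hNh] at h1
    calc rotationDisplacement S hS w (Real.pi / 2)
        ≤ N * rotationDisplacement S hS w h := h1
      _ ≤ N * (2 * (h ^ 2 / 2 * A + h * L)) := by
          refine mul_le_mul_of_nonneg_left (h2.trans ?_) hN'.le
          gcongr
      _ = (N * h) ^ 2 * A * (1 / N) + 2 * (N * h) * L := by field_simp
      _ = _ := by rw [hNh]; ring
  have hlim : Filter.Tendsto (fun N : ℕ => (Real.pi / 2) ^ 2 * A * (1 / (N : ℝ)) + Real.pi * L)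
      Filter.atTop (nhds ((Real.pi / 2) ^ 2 * A * 0 + Real.pi * L)) :=
    (tendsto_one_div_atTop_nhds_zero_nat.const_mul _).add_const _
  rw [mul_zero, zero_add] at hlim
  exact ge_of_tendsto hlim (Filter.eventually_atTop.2 ⟨1, fun N hN => key N hN⟩)

/-- The mean absolute deviation of a maximum of Gaussian variables is at most a constant times
the largest standard deviation. -/
theorem integral_abs_supInner_sub_le (hw : ∀ j ∈ S, ‖w j‖ ≤ L) :
    ∫ x, |supInner S hS w x - ∫ y, supInner S hS w y ∂(stdGaussian E)| ∂(stdGaussian E) ≤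
      Real.pi * L := by
  -- A quarter turn replaces x by the independent copy y; averaging over y inside the absolute value
  -- gives the mean.
  refine le_trans ?_ (rotationDisplacement_pi_div_two_le (hS := hS) hw)
  have hi : Integrable (fun p : E × E => |supInner S hS w p.1 -
      supInner S hS w (Real.cos (Real.pi / 2) • p.1 + Real.sin (Real.pi / 2) • p.2)|)
      ((stdGaussian E).prod (stdGaussian E)) :=
    (integrable_supInner_fst.sub (integrable_supInner_rotation _)).abs
  rw [rotationDisplacement, integral_prod _ hi]
  refine integral_mono (integrable_supInner.sub (integrable_const _)).abs hi.integral_prod_left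
    fun x => ?_
  simp only [Real.cos_pi_div_two, Real.sin_pi_div_two, zero_smul, one_smul, zero_add]
  have : supInner S hS w x - ∫ y, supInner S hS w y ∂(stdGaussian E) =
      ∫ y, (supInner S hS w x - supInner S hS w y) ∂(stdGaussian E) := by
    rw [integral_sub (integrable_const _) integrable_supInner]
    simp
  rw [this]
  exact abs_integral_le_integral_abs

end GaussianMaximum

/-! ### Maximum matchings and the vertices they cover -/

section Matchings

variable {V : Type*}

open Classical in
/-- The vertices covered by a set of edges. -/
noncomputable def coveredVertices (M : Finset (V × V)) : Finset V :=
  M.biUnion fun e => {e.1, e.2}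

theorem sum_coveredVertices {M : Finset (V × V)} (hM : IsEdgeMatching M) (f : V → ℝ) :
    ∑ i ∈ coveredVertices M, f i = ∑ e ∈ M, (f e.1 + f e.2) := by
  classical
  rw [coveredVertices, Finset.sum_biUnion]
  · exact Finset.sum_congr rfl fun e he => Finset.sum_pair (hM.1 e he)
  · intro e he e' he' hne
    have := hM.2 e he e' he' hne
    simp only [Function.onFun, Finset.disjoint_left, Finset.mem_insert, Finset.mem_singleton]
    grind

variable [Fintype V]

theorem exists_maximum_matching (A : Set (V × V)) :
    ∃ M : Finset (V × V), (∀ e ∈ M, e ∈ A) ∧ IsEdgeMatching M ∧ M.card = maxMatchingSize A := by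
  classical
  have hne : ((Finset.univ : Finset (Finset (V × V))).filter
      (fun M => (∀ e ∈ M, e ∈ A) ∧ IsEdgeMatching M)).Nonempty :=
    ⟨∅, by simp [IsEdgeMatching]⟩
  obtain ⟨M, hM, h⟩ := Finset.exists_mem_eq_sup _ hne Finset.card
  obtain ⟨-, h1, h2⟩ := Finset.mem_filter.1 hM
  refine ⟨M, h1, h2, ?_⟩
  rw [← h, maxMatchingSize]

/-- A matching of maximum size contained in a set of edges. -/
noncomputable def maximumMatching (A : Set (V × V)) : Finset (V × V) :=
  (exists_maximum_matching A).choose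

theorem mem_of_mem_maximumMatching {A : Set (V × V)} {e : V × V} (he : e ∈ maximumMatching A) :
    e ∈ A :=
  (exists_maximum_matching A).choose_spec.1 e he

theorem isEdgeMatching_maximumMatching (A : Set (V × V)) : IsEdgeMatching (maximumMatching A) :=
  (exists_maximum_matching A).choose_spec.2.1

theorem card_maximumMatching (A : Set (V × V)) : (maximumMatching A).card = maxMatchingSize A :=
  (exists_maximum_matching A).choose_spec.2.2

theorem maxMatchingSize_eq_zero_of_subsingleton [Subsingleton V] (A : Set (V × V)) :
    maxMatchingSize A = 0 := by
  rw [← card_maximumMatching, Finset.card_eq_zero, Finset.eq_empty_iff_forall_notMem]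
  exact fun e he => (isEdgeMatching_maximumMatching A).1 e he (Subsingleton.elim _ _)

open Classical in
/-- The indicator that a vertex is covered by the chosen maximum matching. -/
noncomputable def coverIndicator (A : Set (V × V)) (i : V) : ℝ :=
  if i ∈ coveredVertices (maximumMatching A) then 1 else 0

theorem sum_coverIndicator_mul (A : Set (V × V)) (f : V → ℝ) :
    ∑ i, coverIndicator A i * f i = ∑ e ∈ maximumMatching A, (f e.1 + f e.2) := by
  classical
  rw [← sum_coveredVertices (isEdgeMatching_maximumMatching A)]
  simp [coverIndicator]

end Matchings

/-! ### Growth of the mean stretch along matchings -/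

section StretchedEdges

variable {V : Type*} {m : ℕ} {v : V → EuclideanSpace ℝ (Fin m)} {Δ : ℝ}

theorem measurable_stretchedEdges : Measurable (stretchedEdges v Δ) := by
  refine measurable_set_iff.2 fun e => measurableSet_setOfPred.1 ?_
  have h : Measurable fun g => inner ℝ (v e.2 - v e.1) g := by fun_prop
  exact (measurableSet_le measurable_const h).inter (MeasurableSet.const _)

/-- The random edge set takes finitely many values, so every function of it is integrable, including
those built on the arbitrary choice in `maximumMatching`. -/
theorem integrable_comp_stretchedEdges [Finite V] (F : Set (V × V) → ℝ)
    (μ : Measure (EuclideanSpace ℝ (Fin m))) [IsFiniteMeasure μ] :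
    Integrable (fun g => F (stretchedEdges v Δ g)) μ :=
  (Integrable.of_finite (f := F)).comp_measurable measurable_stretchedEdges

theorem swap_mem_stretchedEdges_neg {g : EuclideanSpace ℝ (Fin m)} {e : V × V}
    (he : e ∈ stretchedEdges v Δ g) : e.swap ∈ stretchedEdges v Δ (-g) := by
  obtain ⟨h1, h2⟩ := he
  refine ⟨?_, by rwa [Prod.fst_swap, Prod.snd_swap, norm_sub_rev]⟩
  rw [Prod.fst_swap, Prod.snd_swap, inner_neg_right, ← inner_neg_left, neg_sub]
  exact h1

variable [Fintype V]

open Classical in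
/-- The vertices whose squared distance from `i` is at most `r`. -/
noncomputable def nearby (v : V → EuclideanSpace ℝ (Fin m)) (r : ℝ) (i : V) : Finset V :=
  {j | ‖v j - v i‖ ^ 2 ≤ r}

theorem mem_nearby {r : ℝ} {i j : V} : j ∈ nearby v r i ↔ ‖v j - v i‖ ^ 2 ≤ r := by
  simp [nearby]

theorem self_mem_nearby {r : ℝ} (hr : 0 ≤ r) (i : V) : i ∈ nearby v r i := by
  simpa [mem_nearby] using hr

/-- The largest value of `⟨v j - v i, g⟩` over the vertices `j` at squared distance at most `r`
from `i`. -/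
noncomputable def maxStretch (v : V → EuclideanSpace ℝ (Fin m)) {r : ℝ} (hr : 0 ≤ r) (i : V)
    (g : EuclideanSpace ℝ (Fin m)) : ℝ :=
  supInner (nearby v r i) ⟨i, self_mem_nearby hr i⟩ (fun j => v j - v i) g

/-- The mean of `maxStretch`. -/
noncomputable def meanStretch (v : V → EuclideanSpace ℝ (Fin m)) {r : ℝ} (hr : 0 ≤ r) (i : V) : ℝ :=
  ∫ g, maxStretch v hr i g ∂(stdGaussian (EuclideanSpace ℝ (Fin m)))

theorem norm_le_sqrt_of_mem_nearby {r : ℝ} {i j : V} (h : j ∈ nearby v r i) :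
    ‖v j - v i‖ ≤ Real.sqrt r :=
  Real.le_sqrt_of_sq_le (mem_nearby.1 h)

theorem maxStretch_add_two_le (hv : SqTriangleInequality v) {r s : ℝ} (hr : 0 ≤ r) (hs : 0 ≤ s)
    (hrs : r + Δ ≤ s) {g : EuclideanSpace ℝ (Fin m)} {e : V × V}
    (he : e ∈ stretchedEdges v Δ g) :
    maxStretch v hr e.2 g + 2 ≤ maxStretch v hs e.1 g := by
  obtain ⟨h1, h2⟩ := he
  obtain ⟨j, hj, h⟩ := exists_supInner_eq (nearby v r e.2) ⟨e.2, self_mem_nearby hr e.2⟩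
    (fun j => v j - v e.2) g
  have hmem : j ∈ nearby v s e.1 := by
    have := hv j e.1 e.2
    rw [mem_nearby] at hj ⊢
    rw [norm_sub_rev] at h2
    linarith
  have hle : inner ℝ (v j - v e.1) g ≤ maxStretch v hs e.1 g :=
    inner_le_supInner (w := fun j => v j - v e.1) hmem g
  rw [maxStretch, h]
  have : v j - v e.1 = (v j - v e.2) + (v e.2 - v e.1) := by abel
  rw [this, inner_add_left] at hle
  linarith

theorem integrable_maxStretch {r : ℝ} (hr : 0 ≤ r) (i : V) :
    Integrable (maxStretch v hr i) (stdGaussian (EuclideanSpace ℝ (Fin m))) :=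
  integrable_supInner

theorem meanStretch_nonneg {r : ℝ} (hr : 0 ≤ r) (i : V) : 0 ≤ meanStretch v hr i := by
  refine integral_nonneg fun g => ?_
  have : inner ℝ (v i - v i) g ≤ maxStretch v hr i g :=
    inner_le_supInner (w := fun j => v j - v i) (self_mem_nearby hr i) g
  simpa using this

theorem meanStretch_le {r : ℝ} (hr : 0 ≤ r) (i : V) {t : ℝ} (ht : 0 < t) :
    meanStretch v hr i ≤ (Real.log (Fintype.card V) + t ^ 2 * r / 2) / t := by
  have h := integral_supInner_le (hS := ⟨i, self_mem_nearby hr i⟩)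
    (fun j hj => norm_le_sqrt_of_mem_nearby (v := v) (i := i) hj) ht
  rw [Real.sq_sqrt hr] at h
  refine h.trans ?_
  have hc : (0 : ℝ) < (nearby v r i).card := by
    exact_mod_cast Finset.card_pos.2 ⟨i, self_mem_nearby hr i⟩
  gcongr
  exact Finset.card_le_univ _

/-- The total deviation of `maxStretch` at `i` from its mean, in the directions `g` and `-g`. -/
noncomputable def stretchDeviation (v : V → EuclideanSpace ℝ (Fin m)) {r : ℝ} (hr : 0 ≤ r) (i : V)
    (g : EuclideanSpace ℝ (Fin m)) : ℝ :=
  |maxStretch v hr i g - meanStretch v hr i| + |maxStretch v hr i (-g) - meanStretch v hr i|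

theorem stretchDeviation_nonneg {r : ℝ} (hr : 0 ≤ r) (i : V) (g : EuclideanSpace ℝ (Fin m)) :
    0 ≤ stretchDeviation v hr i g := by
  unfold stretchDeviation
  positivity

theorem measurePreserving_neg_stdGaussian :
    MeasurePreserving (fun g => -g) (stdGaussian (EuclideanSpace ℝ (Fin m)))
      (stdGaussian (EuclideanSpace ℝ (Fin m))) where
  measurable := measurable_neg
  map_eq := stdGaussian_map (LinearIsometryEquiv.neg ℝ)

theorem integrable_abs_maxStretch_sub {r : ℝ} (hr : 0 ≤ r) (i : V) :
    Integrable (fun g => |maxStretch v hr i g - meanStretch v hr i|)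
      (stdGaussian (EuclideanSpace ℝ (Fin m))) :=
  ((integrable_maxStretch hr i).sub (integrable_const _)).abs

theorem integrable_stretchDeviation {r : ℝ} (hr : 0 ≤ r) (i : V) :
    Integrable (stretchDeviation v hr i) (stdGaussian (EuclideanSpace ℝ (Fin m))) :=
  (integrable_abs_maxStretch_sub hr i).add
    (measurePreserving_neg_stdGaussian.integrable_comp_of_integrable
      (integrable_abs_maxStretch_sub hr i))

theorem integral_stretchDeviation_le {r : ℝ} (hr : 0 ≤ r) (i : V) :
    ∫ g, stretchDeviation v hr i g ∂(stdGaussian (EuclideanSpace ℝ (Fin m))) ≤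
      2 * (Real.pi * Real.sqrt r) := by
  have h : ∫ g, |maxStretch v hr i g - meanStretch v hr i|
      ∂(stdGaussian (EuclideanSpace ℝ (Fin m))) ≤ Real.pi * Real.sqrt r :=
    integral_abs_supInner_sub_le fun j hj => norm_le_sqrt_of_mem_nearby hj
  have hneg : ∫ g, |maxStretch v hr i (-g) - meanStretch v hr i|
      ∂(stdGaussian (EuclideanSpace ℝ (Fin m))) =
      ∫ g, |maxStretch v hr i g - meanStretch v hr i|
        ∂(stdGaussian (EuclideanSpace ℝ (Fin m))) :=
    measurePreserving_neg_stdGaussian.integral_comp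
      (Homeomorph.neg (EuclideanSpace ℝ (Fin m))).measurableEmbedding
      (fun g => |maxStretch v hr i g - meanStretch v hr i|)
  simp only [stretchDeviation]
  have hi : Integrable (fun g => |maxStretch v hr i (-g) - meanStretch v hr i|)
      (stdGaussian (EuclideanSpace ℝ (Fin m))) :=
    measurePreserving_neg_stdGaussian.integrable_comp_of_integrable
      (integrable_abs_maxStretch_sub hr i)
  rw [integral_add (integrable_abs_maxStretch_sub hr i) hi, hneg]
  linarith

/-- For a fixed direction, the mean stretch of the covered vertices grows when the radius grows
by `Δ`, up to the deviations from the means. -/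
theorem four_mul_maxMatchingSize_le (hv : SqTriangleInequality v) {r s : ℝ} (hr : 0 ≤ r)
    (hs : 0 ≤ s) (hrs : r + Δ ≤ s) (g : EuclideanSpace ℝ (Fin m)) :
    4 * (maxMatchingSize (stretchedEdges v Δ g) : ℝ) ≤
      ∑ i, coverIndicator (stretchedEdges v Δ g) i * (meanStretch v hs i - meanStretch v hr i) +
      ∑ i, (stretchDeviation v hs i g + stretchDeviation v hr i g) := by
  set A := stretchedEdges v Δ g with hA
  set R : V → ℝ := fun i => stretchDeviation v hs i g + stretchDeviation v hr i g with hR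
  have hRle : ∑ i, coverIndicator A i * R i ≤ ∑ i, R i := by
    refine Finset.sum_le_sum fun i _ => mul_le_of_le_one_left
      (add_nonneg (stretchDeviation_nonneg hs i g) (stretchDeviation_nonneg hr i g)) ?_
    unfold coverIndicator
    split_ifs <;> norm_num
  refine le_trans ?_ (add_le_add_right hRle _)
  rw [sum_coverIndicator_mul, sum_coverIndicator_mul, ← Finset.sum_add_distrib,
    ← card_maximumMatching, mul_comm, ← nsmul_eq_mul]
  refine Finset.card_nsmul_le_sum _ _ _ fun e he => ?_
  have h1 := mem_of_mem_maximumMatching he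
  -- One direction alone compares different endpoints. Using g and -g together, each endpoint
  -- appears at both radii, with total gain 4 per edge.
  have h2 := maxStretch_add_two_le hv hr hs hrs h1
  have h3 := maxStretch_add_two_le hv hr hs hrs (swap_mem_stretchedEdges_neg h1)
  simp only [Prod.fst_swap, Prod.snd_swap] at h3
  simp only [hR, stretchDeviation]
  have a1 := le_abs_self (maxStretch v hs e.1 g - meanStretch v hs e.1)
  have a2 := le_abs_self (maxStretch v hs e.2 (-g) - meanStretch v hs e.2)
  have a3 := neg_abs_le (maxStretch v hr e.2 g - meanStretch v hr e.2)
  have a4 := neg_abs_le (maxStretch v hr e.1 (-g) - meanStretch v hr e.1)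
  have b1 := abs_nonneg (maxStretch v hs e.1 (-g) - meanStretch v hs e.1)
  have b2 := abs_nonneg (maxStretch v hs e.2 g - meanStretch v hs e.2)
  have b3 := abs_nonneg (maxStretch v hr e.2 (-g) - meanStretch v hr e.2)
  have b4 := abs_nonneg (maxStretch v hr e.1 g - meanStretch v hr e.1)
  linarith

/-- The expected size of a maximum matching of stretched edges. -/
noncomputable def expectedMatchingSize (v : V → EuclideanSpace ℝ (Fin m)) (Δ : ℝ) : ℝ :=
  ∫ g, (maxMatchingSize (stretchedEdges v Δ g) : ℝ) ∂(stdGaussian (EuclideanSpace ℝ (Fin m)))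

/-- The probability that a vertex is covered by the chosen maximum matching. -/
noncomputable def coverProbability (v : V → EuclideanSpace ℝ (Fin m)) (Δ : ℝ) (i : V) : ℝ :=
  ∫ g, coverIndicator (stretchedEdges v Δ g) i ∂(stdGaussian (EuclideanSpace ℝ (Fin m)))

theorem coverProbability_nonneg (i : V) : 0 ≤ coverProbability v Δ i := by
  refine integral_nonneg fun g => ?_
  unfold coverIndicator
  split_ifs <;> norm_num

theorem integral_sum_coverIndicator_mul (f : V → ℝ) :
    ∫ g, ∑ i, coverIndicator (stretchedEdges v Δ g) i * f i
      ∂(stdGaussian (EuclideanSpace ℝ (Fin m))) = ∑ i, coverProbability v Δ i * f i := by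
  rw [integral_finsetSum _ fun i _ =>
    integrable_comp_stretchedEdges (fun A => coverIndicator A i * f i) _]
  simp_rw [integral_mul_const]
  rfl

theorem sum_coverProbability :
    ∑ i, coverProbability v Δ i = 2 * expectedMatchingSize v Δ := by
  have h := integral_sum_coverIndicator_mul (v := v) (Δ := Δ) fun _ => 1
  simp only [mul_one] at h
  rw [← h, expectedMatchingSize, ← integral_const_mul]
  congr 1 with g
  have := sum_coverIndicator_mul (stretchedEdges v Δ g) fun _ => 1
  simp only [mul_one] at this
  rw [this, ← card_maximumMatching]
  norm_num
  ring

theorem four_mul_expectedMatchingSize_le (hv : SqTriangleInequality v) {r s : ℝ} (hr : 0 ≤ r)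
    (hs : 0 ≤ s) (hrs : r + Δ ≤ s) {ρ : ℝ} (hrρ : r ≤ ρ) (hsρ : s ≤ ρ) :
    4 * expectedMatchingSize v Δ ≤
      ∑ i, coverProbability v Δ i * (meanStretch v hs i - meanStretch v hr i) +
      Fintype.card V * (4 * (Real.pi * Real.sqrt ρ)) := by
  have hD (i : V) : Integrable (fun g => stretchDeviation v hs i g + stretchDeviation v hr i g)
      (stdGaussian (EuclideanSpace ℝ (Fin m))) :=
    (integrable_stretchDeviation hs i).add (integrable_stretchDeviation hr i)
  have hC : Integrable (fun g => ∑ i, coverIndicator (stretchedEdges v Δ g) i *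
      (meanStretch v hs i - meanStretch v hr i)) (stdGaussian (EuclideanSpace ℝ (Fin m))) :=
    integrable_comp_stretchedEdges
      (fun A => ∑ i, coverIndicator A i * (meanStretch v hs i - meanStretch v hr i)) _
  have hI := integral_mono
    ((integrable_comp_stretchedEdges (v := v) (Δ := Δ) (fun A => (maxMatchingSize A : ℝ))
      (stdGaussian (EuclideanSpace ℝ (Fin m)))).const_mul 4)
    (hC.add (integrable_finsetSum Finset.univ fun i _ => hD i))
    (four_mul_maxMatchingSize_le hv hr hs hrs)
  simp only [Pi.add_apply] at hI
  rw [integral_const_mul, integral_add hC (integrable_finsetSum Finset.univ fun i _ => hD i),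
    integral_sum_coverIndicator_mul, integral_finsetSum _ fun i _ => hD i] at hI
  refine hI.trans ?_
  gcongr
  rw [← Finset.card_univ, ← nsmul_eq_mul]
  refine Finset.sum_le_card_nsmul _ _ _ fun i _ => ?_
  rw [integral_add (integrable_stretchDeviation hs i) (integrable_stretchDeviation hr i)]
  have h1 := integral_stretchDeviation_le (v := v) hs i
  have h2 := integral_stretchDeviation_le (v := v) hr i
  have h3 := mul_le_mul_of_nonneg_left (Real.sqrt_le_sqrt hsρ) Real.pi_pos.le
  have h4 := mul_le_mul_of_nonneg_left (Real.sqrt_le_sqrt hrρ) Real.pi_pos.le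
  linarith

/-- If the matching is large on average, then the weighted mean stretch grows linearly with the
number of steps. -/
theorem mul_expectedMatchingSize_le_sum (hv : SqTriangleInequality v) (hΔ : 0 ≤ Δ) {ρ c : ℝ}
    (hρ : Real.pi * Real.sqrt ρ ≤ c / 2)
    (hc : c * Fintype.card V ≤ expectedMatchingSize v Δ) (K : ℕ) (hK : K * Δ ≤ ρ) :
    2 * K * expectedMatchingSize v Δ ≤
      ∑ i, coverProbability v Δ i * meanStretch v (mul_nonneg K.cast_nonneg hΔ : 0 ≤ K * Δ) i := by
  induction K with
  | zero =>
    simp only [Nat.cast_zero, mul_zero, zero_mul]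
    exact Finset.sum_nonneg fun i _ =>
      mul_nonneg (coverProbability_nonneg i) (meanStretch_nonneg _ i)
  | succ K ih =>
    have hle : (K : ℝ) * Δ + Δ ≤ (K + 1 : ℕ) * Δ := by push_cast; linarith
    have hK' : K * Δ ≤ ρ := by linarith
    have h := four_mul_expectedMatchingSize_le hv (mul_nonneg K.cast_nonneg hΔ : 0 ≤ K * Δ)
      (mul_nonneg (Nat.cast_nonneg _) hΔ : 0 ≤ (K + 1 : ℕ) * Δ) hle hK' hK
    simp only [mul_sub, Finset.sum_sub_distrib] at h
    have hn : (0 : ℝ) ≤ Fintype.card V := Nat.cast_nonneg _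
    -- The error 4πn√ρ is at most 2cn ≤ 2·E[β], so at least half of the gain 4·E[β] survives each
    -- step.
    have := mul_le_mul_of_nonneg_left hρ hn
    have := ih hK'
    push_cast at *
    linarith

/-- The cover probabilities sum to 2·E[β], so E[β] cancels from the lower and upper bounds, leaving
K ≤ 2Δ log n. -/
theorem expectedMatchingSize_le (hv : SqTriangleInequality v) (hΔ : 0 < Δ) {c : ℝ} (hc : 0 ≤ c)
    {ρ : ℝ} (hρ : Real.pi * Real.sqrt ρ ≤ c / 2) {K : ℕ} (hK : K * Δ ≤ ρ)
    (hKn : 2 * Δ * Real.log (Fintype.card V) < K) :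
    expectedMatchingSize v Δ ≤ c * Fintype.card V := by
  by_contra! hlt
  have hpos : 0 < expectedMatchingSize v Δ := lt_of_le_of_lt (by positivity) hlt
  have h1 := mul_expectedMatchingSize_le_sum hv hΔ.le hρ hlt.le K hK
  have h2 : ∑ i, coverProbability v Δ i *
      meanStretch v (mul_nonneg K.cast_nonneg hΔ.le : 0 ≤ K * Δ) i ≤
      ∑ i, coverProbability v Δ i * (Δ * Real.log (Fintype.card V) + K / 2) := by
    refine Finset.sum_le_sum fun i _ => mul_le_mul_of_nonneg_left ?_ (coverProbability_nonneg i)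
    -- At radius KΔ, the parameter t = 1/Δ makes the quadratic term K/2, half of what K steps gain.
    refine (meanStretch_le _ i (inv_pos.2 hΔ)).trans (le_of_eq ?_)
    field_simp
  rw [← Finset.sum_mul, sum_coverProbability] at h2
  have h3 : expectedMatchingSize v Δ * (2 * K) ≤
      expectedMatchingSize v Δ * (2 * (Δ * Real.log (Fintype.card V) + K / 2)) := by linarith
  have := le_of_mul_le_mul_left h3 hpos
  linarith

end StretchedEdges

/-! ### Choice of the constants -/

theorem mainTheorem1 (c : ℝ) (hc : 0 < c) :
    ∃ Δ : ℕ → ℝ,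
      (∃ a b : ℝ, 0 < a ∧ 0 < b ∧ ∀ n : ℕ, 2 ≤ n →
        a / Real.sqrt (Real.log n) ≤ Δ n ∧ Δ n ≤ b / Real.sqrt (Real.log n)) ∧
      ∀ (n m : ℕ) (V : Type*) [Fintype V], Fintype.card V = n →
        ∀ v : V → EuclideanSpace ℝ (Fin m), SqTriangleInequality v →
          MeasureTheory.Integrable
            (fun g => (maxMatchingSize (stretchedEdges v (Δ n) g) : ℝ))
            (ProbabilityTheory.stdGaussian (EuclideanSpace ℝ (Fin m))) ∧
          ∫ g, (maxMatchingSize (stretchedEdges v (Δ n) g) : ℝ)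
            ∂(ProbabilityTheory.stdGaussian (EuclideanSpace ℝ (Fin m))) ≤ c * n := by
  set ρ : ℝ := (c / (2 * Real.pi)) ^ 2 with hρ
  have hρ0 : 0 < ρ := by positivity
  -- The first bound gives Δ ≤ ρ, since √(log n) ≥ 1/2 for n ≥ 2; the second gives 4Δ² log n = 4a² ≤
  -- ρ.
  set a : ℝ := min (ρ / 2) (Real.sqrt ρ / 4) with ha
  have ha0 : 0 < a := by positivity
  refine ⟨fun n => a / Real.sqrt (Real.log n), ⟨a, a, ha0, ha0, fun n _ => ⟨le_rfl, le_rfl⟩⟩, ?_⟩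
  intro n m V _ hV v hv
  refine ⟨integrable_comp_stretchedEdges (fun A => (maxMatchingSize A : ℝ)) _, ?_⟩
  rcases lt_or_ge n 2 with hn | hn
  -- Matchings have no loops, so they are empty on at most one vertex, whatever the junk value of Δ.
  · have : Subsingleton V := Fintype.card_le_one_iff_subsingleton.1 (by omega)
    simp only [maxMatchingSize_eq_zero_of_subsingleton, Nat.cast_zero, integral_zero]
    positivity
  · set s := Real.sqrt (Real.log n) with hs
    have hlog : (1 / 2 : ℝ) ^ 2 ≤ Real.log n := by
      have h1 : Real.log 2 ≤ Real.log n :=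
        Real.log_le_log (by norm_num) (by exact_mod_cast hn)
      have := Real.log_two_gt_d9
      linarith
    have hs2 : 1 / 2 ≤ s := Real.le_sqrt_of_sq_le hlog
    have hs0 : 0 < s := by linarith
    have hsq : s ^ 2 = Real.log n := Real.sq_sqrt (le_trans (by positivity) hlog)
    set Δ := a / s with hΔ
    have hΔ0 : 0 < Δ := by positivity
    have hΔs : Δ * s = a := by rw [hΔ]; field_simp
    have hΔρ : 1 ≤ ρ / Δ := by
      rw [one_le_div hΔ0, hΔ, div_le_iff₀ hs0]
      have := min_le_left (ρ / 2) (Real.sqrt ρ / 4)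
      nlinarith
    -- A floor that is at least 1 exceeds half of its argument; this supplies the strict inequality
    -- needed for K.
    have hfloor : ρ / Δ / 2 < ⌊ρ / Δ⌋₊ := by
      have h1 := Nat.lt_floor_add_one (ρ / Δ)
      have h2 : (1 : ℝ) ≤ ⌊ρ / Δ⌋₊ := by exact_mod_cast Nat.le_floor (by exact_mod_cast hΔρ)
      linarith
    suffices h : expectedMatchingSize v Δ ≤ c * Fintype.card V by rwa [hV] at h
    refine expectedMatchingSize_le hv hΔ0 hc.le (ρ := ρ) (K := ⌊ρ / Δ⌋₊) ?_ ?_ ?_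
    · rw [hρ, Real.sqrt_sq (by positivity)]
      apply le_of_eq
      field_simp
    · rw [← le_div_iff₀ hΔ0]
      exact Nat.floor_le (by positivity)
    · refine lt_of_le_of_lt ?_ hfloor
      rw [hV, ← hsq, div_div, le_div_iff₀ (by positivity)]
      have h1 : a ^ 2 ≤ ρ / 16 := by
        calc a ^ 2 ≤ (Real.sqrt ρ / 4) ^ 2 := by gcongr; exact min_le_right _ _
          _ = ρ / 16 := by rw [div_pow, Real.sq_sqrt hρ0.le]; norm_num
      calc 2 * Δ * s ^ 2 * (Δ * 2) = 4 * (Δ * s) ^ 2 := by ring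
        _ ≤ ρ := by rw [hΔs]; linarith
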